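/- Let $U$ be the Urysohn metric space $\mathbb{U}_1$ of diameter $1$, that is, the (up to isometry unique) complete separable metric space of diameter at most $1$ with the following extension property: if $Y=X\cup\{y\}$ is a finite metric space of diameter at most $1$ ($y\notin X$, $X$ possibly empty), then every isometric embedding of $X$ into $U$ extends to an isometric embedding of $Y$ into $U$. Let $\mathrm{Iso}(U)$ be the group of all isometries of $U$ onto itself, equipped with the topology of pointwise convergence. Then: (a) $\mathrm{Iso}(U)$ is approximately oligomorphic: for all $n\ge 1$ and $\epsilon>0$ there is a finite set $A\subseteq U^n$ such that $\mathrm{Iso}(U)\cdot A$ is $\epsilon$-dense in $U^n$ with respect to the supremum metric $d_\infty$, i.e. for each $x\in U^n$ there are $a\in A$ and $g\in \mathrm{Iso}(U)$ with $\max_i d(x_i,g a_i)<\epsilon$; (b) and hence $\mathrm{Iso}(U)$ has property (OB): whenever the topological group $\mathrm{Iso}(U)$ acts by isometries on a metric space $Z$ in such a way that for each $z\in Z$ the map $g\mapsto gz$ is continuous, every orbit is bounded. -/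

import Mathlib

open Topology

/-- The isometry group of a metric space carries the topology of pointwise convergence. -/
instance IsometryEquiv.pointwiseTopology {X : Type*} [MetricSpace X] :
    TopologicalSpace (X ≃ᵢ X) :=
  TopologicalSpace.induced (fun (g : X ≃ᵢ X) (x : X) => g x) inferInstance

theorem IsometryEquiv.tendsto_pointwise_iff {X : Type*} [MetricSpace X] {ι : Type*}
    {l : Filter ι} {f : ι → (X ≃ᵢ X)} {g : X ≃ᵢ X} :
    Filter.Tendsto f l (𝓝 g) ↔ ∀ x, Filter.Tendsto (fun i => f i x) l (𝓝 (g x)) := by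
  rw [nhds_induced, Filter.tendsto_comap_iff, tendsto_pi_nhds]
  rfl

/-- With the topology of pointwise convergence, the isometry group is a topological group. -/
instance IsometryEquiv.isTopologicalGroup_pointwise {X : Type*} [MetricSpace X] :
    IsTopologicalGroup (X ≃ᵢ X) where
  continuous_mul := by
    rw [continuous_iff_continuousAt]
    rintro ⟨g, h⟩
    refine IsometryEquiv.tendsto_pointwise_iff.2 fun x => ?_
    have h1 : Filter.Tendsto (fun p : (X ≃ᵢ X) × (X ≃ᵢ X) => p.1 (h x)) (𝓝 (g, h))
        (𝓝 (g (h x))) :=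
      IsometryEquiv.tendsto_pointwise_iff.1 (continuous_fst.tendsto (g, h)) (h x)
    have h2 : Filter.Tendsto (fun p : (X ≃ᵢ X) × (X ≃ᵢ X) => p.2 x) (𝓝 (g, h)) (𝓝 (h x)) :=
      IsometryEquiv.tendsto_pointwise_iff.1 (continuous_snd.tendsto (g, h)) x
    refine h1.congr_dist ?_
    refine (tendsto_iff_dist_tendsto_zero.1 h2).congr fun p => ?_
    rw [dist_comm (p.1 (h x))]
    exact (p.1.dist_eq (p.2 x) (h x)).symm
  continuous_inv := by
    rw [continuous_iff_continuousAt]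
    intro g
    refine IsometryEquiv.tendsto_pointwise_iff.2 fun x => ?_
    have h1 : Filter.Tendsto (fun p : X ≃ᵢ X => p (g⁻¹ x)) (𝓝 g) (𝓝 (g (g⁻¹ x))) :=
      IsometryEquiv.tendsto_pointwise_iff.1 Filter.tendsto_id (g⁻¹ x)
    rw [IsometryEquiv.apply_inv_self] at h1
    rw [tendsto_iff_dist_tendsto_zero] at h1 ⊢
    refine h1.congr fun p => ?_
    rw [← p.dist_eq (p⁻¹ x) (g⁻¹ x), IsometryEquiv.apply_inv_self, dist_comm]

/-- `U` is the Urysohn metric space of diameter `1`: a complete separable metric space of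
diameter at most `1` such that, whenever `Y` is a finite metric space of diameter at most `1`
and `y` is a point of `Y`, each isometric embedding into `U` of `X = Y \ {y}` extends to an
isometric embedding of `Y`. Here `X` may be empty, so `U` is non-empty. A finite metric space is
isometric to one whose underlying type is in the lowest universe. -/
structure IsUrysohnOne (U : Type*) [MetricSpace U] : Prop where
  complete : CompleteSpace U
  separable : TopologicalSpace.SeparableSpace U
  dist_le_one : ∀ x y : U, dist x y ≤ 1
  extension : ∀ (Y : Type) [MetricSpace Y] [Finite Y], (∀ a b : Y, dist a b ≤ 1) →
    ∀ (y : Y) (φ : {x : Y // x ≠ y} → U), Isometry φ →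
      ∃ ψ : Y → U, Isometry ψ ∧ ∀ x : {x : Y // x ≠ y}, ψ x = φ x

/-- A group `G` of isometries of `X` is approximately oligomorphic: for all `n ≥ 1` and `ε > 0`
there is a finite `A ⊆ Xⁿ` with `G · A` being `ε`-dense in `Xⁿ` for the supremum metric, which is
the metric that `Fin n → X` carries. -/
def IsApproxOligomorphic {X : Type*} [MetricSpace X] (G : Subgroup (X ≃ᵢ X)) : Prop :=
  ∀ n : ℕ, 1 ≤ n → ∀ ε : ℝ, 0 < ε →
    ∃ A : Set (Fin n → X), A.Finite ∧
      ∀ x : Fin n → X, ∃ a ∈ A, ∃ g ∈ G, dist x (fun i => g (a i)) < ε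

universe u v

/-- Property (OB) of a topological group `G`: for every action of `G` by isometries on a metric
space such that all orbit maps `g ↦ g • x` are continuous, every orbit is bounded. -/
def HasPropertyOB (G : Type u) [Group G] [TopologicalSpace G] [IsTopologicalGroup G] : Prop :=
  ∀ (X : Type v) [MetricSpace X] [MulAction G X] [IsIsometricSMul G X],
    (∀ x : X, Continuous fun g : G => g • x) →
      ∀ x : X, Bornology.IsBounded (MulAction.orbit G x)

/-! By back-and-forth, finite partial isometries of `U` extend to isometries of `U`, so a finite
tuple is determined up to `Iso(U)` by its distance matrix. Matrices within `2ε` entrywise belong to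
tuples that an isometry brings within `ε`: glue the tuples at distance `ε`, embed the result over
the first one, and move the second onto its copy. The matrices lie in a compact cube, so finitely
many tuples suffice, which is (a).

For (b), apply this to tuples listing a finite set and its image under `g`: each identity
neighbourhood `V` has a finite `F` with `Iso(U) = V F V`. Choosing `V` to move `z` by less than `1`
bounds the orbit of `z`. -/

namespace IsUrysohnOne

variable {U : Type*} [MetricSpace U]

/-- A map on a finite set `s` of a metric space of diameter at most `1` that preserves distances
extends to one more point. -/
theorem exists_dist_eq (hU : IsUrysohnOne U) {Y : Type*} [MetricSpace Y]
    (hY : ∀ a b : Y, dist a b ≤ 1) {s : Set Y} (hs : s.Finite) (φ : Y → U)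
    (hφ : ∀ a ∈ s, ∀ b ∈ s, dist (φ a) (φ b) = dist a b) (y : Y) :
    ∃ v : U, ∀ a ∈ s, dist v (φ a) = dist y a := by
  by_cases hy : y ∈ s
  · exact ⟨φ y, fun a ha => hφ y hy a ha⟩
  have : Finite (insert y s : Set Y) := hs.insert y
  obtain ⟨n, ⟨e⟩⟩ := Finite.exists_equiv_fin (insert y s : Set Y)
  -- The extension property speaks of types in `Type` only, so the metric is transported to `Fin n`.
  let _ : MetricSpace (Fin n) :=
    MetricSpace.induced (fun i => (e.symm i : Y))
      (Subtype.val_injective.comp e.symm.injective) inferInstance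
  have hd : ∀ i j : Fin n, dist i j = dist (e.symm i : Y) (e.symm j) := fun _ _ => rfl
  set y' : Fin n := e ⟨y, Set.mem_insert y s⟩ with hy'
  have hmem : ∀ i : Fin n, i ≠ y' → (e.symm i : Y) ∈ s := by
    intro i hi
    rcases (e.symm i).2 with h | h
    · refine absurd ?_ hi
      rw [hy', ← Equiv.symm_apply_eq]
      exact Subtype.ext h
    · exact h
  obtain ⟨ψ, hψ, hext⟩ := hU.extension (Fin n) (fun i j => hY _ _) y' (fun i => φ (e.symm i.1))
    (Isometry.of_dist_eq fun i j => hφ _ (hmem i.1 i.2) _ (hmem j.1 j.2))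
  refine ⟨ψ y', fun a ha => ?_⟩
  set i : Fin n := e ⟨a, Set.mem_insert_of_mem y ha⟩ with hi
  have hiy : i ≠ y' := by
    intro h
    have := congrArg Subtype.val (e.injective h)
    exact hy ((show a = y from this) ▸ ha)
  have h1 : ψ i = φ a := by
    have := hext ⟨i, hiy⟩
    simpa [hi] using this
  rw [← h1, hψ.dist_eq, hd]
  simp [hi, hy']

/-- A map on a set `s` of a finite metric space of diameter at most `1` that preserves distances
extends to an isometric embedding. -/
theorem exists_isometry_eqOn (hU : IsUrysohnOne U) {Y : Type*} [MetricSpace Y] [Finite Y]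
    (hY : ∀ a b : Y, dist a b ≤ 1) (s : Set Y) (φ : Y → U)
    (hφ : ∀ a ∈ s, ∀ b ∈ s, dist (φ a) (φ b) = dist a b) :
    ∃ ψ : Y → U, Isometry ψ ∧ Set.EqOn ψ φ s := by
  classical
  suffices H : ∀ t : Set Y, ∃ ψ : Y → U,
      (∀ a ∈ s ∪ t, ∀ b ∈ s ∪ t, dist (ψ a) (ψ b) = dist a b) ∧ Set.EqOn ψ φ s by
    obtain ⟨ψ, h1, h2⟩ := H Set.univ
    exact ⟨ψ, Isometry.of_dist_eq fun a b => h1 a (by simp) b (by simp), h2⟩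
  intro t
  induction t, t.toFinite using Set.Finite.induction_on with
  | empty => exact ⟨φ, by simpa using hφ, fun _ _ => rfl⟩
  | @insert y t _ _ ih =>
    obtain ⟨ψ, h1, h2⟩ := ih
    by_cases hy : y ∈ s ∪ t
    · refine ⟨ψ, ?_, h2⟩
      rwa [Set.union_insert, Set.insert_eq_of_mem hy]
    · obtain ⟨v, hv⟩ := hU.exists_dist_eq hY (s ∪ t).toFinite ψ h1 y
      have hne : ∀ a ∈ s ∪ t, a ≠ y := fun a ha h => hy (h ▸ ha)
      refine ⟨Function.update ψ y v, ?_, fun a ha => ?_⟩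
      · rw [Set.union_insert]
        rintro a (rfl | ha) b (rfl | hb)
        · simp
        · simp [Function.update_of_ne (hne b hb), hv b hb]
        · simp [Function.update_of_ne (hne a ha), dist_comm _ v, hv a ha, dist_comm]
        · simp [Function.update_of_ne (hne a ha), Function.update_of_ne (hne b hb), h1 a ha b hb]
      · rw [Function.update_of_ne (hne a (Or.inl ha)), h2 ha]

theorem nonempty (hU : IsUrysohnOne U) : Nonempty U := by
  obtain ⟨ψ, -⟩ := hU.extension Unit (by simp) () (fun x => absurd rfl x.2)
    (Isometry.of_dist_eq fun x => absurd rfl x.2)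
  exact ⟨ψ ()⟩

end IsUrysohnOne

/-! ### Back-and-forth and ultrahomogeneity -/

/-- A relation between two metric spaces, given by its graph, is a partial isometry if it
preserves distances. -/
def IsPartialIsometry {X Y : Type*} [MetricSpace X] [MetricSpace Y] (R : Set (X × Y)) : Prop :=
  ∀ p ∈ R, ∀ q ∈ R, dist p.1 q.1 = dist p.2 q.2

namespace IsPartialIsometry

variable {X Y : Type*} [MetricSpace X] [MetricSpace Y] {R : Set (X × Y)}

theorem swap (hR : IsPartialIsometry R) : IsPartialIsometry (Prod.swap ⁻¹' R) :=
  fun p hp q hq => (hR p.swap hp q.swap hq).symm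

theorem closure (hR : IsPartialIsometry R) : IsPartialIsometry (closure R) := by
  have hcl : IsClosed {z : (X × Y) × (X × Y) | dist z.1.1 z.2.1 = dist z.1.2 z.2.2} :=
    isClosed_eq (by fun_prop) (by fun_prop)
  intro p hp q hq
  have hpq : (p, q) ∈ _root_.closure (R ×ˢ R) := by
    rw [closure_prod_eq]
    exact ⟨hp, hq⟩
  exact closure_minimal (fun z hz => hR z.1 hz.1 z.2 hz.2) hcl hpq

theorem isometry_fst (hR : IsPartialIsometry R) : Isometry fun p : R => p.1.1 :=
  Isometry.of_dist_eq fun p q => by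
    rw [Subtype.dist_eq, Prod.dist_eq, ← hR p.1 p.2 q.1 q.2, max_self]

theorem isometry_snd (hR : IsPartialIsometry R) : Isometry fun p : R => p.1.2 :=
  Isometry.of_dist_eq fun p q => by
    rw [Subtype.dist_eq, Prod.dist_eq, hR p.1 p.2 q.1 q.2, max_self]

/-- A partial isometry with dense domain and dense range between complete spaces extends to an
isometric bijection. -/
theorem exists_isometryEquiv [CompleteSpace X] [CompleteSpace Y] (hR : IsPartialIsometry R)
    (h1 : Dense (Prod.fst '' R)) (h2 : Dense (Prod.snd '' R)) :
    ∃ g : X ≃ᵢ Y, ∀ p ∈ R, g p.1 = p.2 := by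
  have hc := hR.closure
  have : CompleteSpace (_root_.closure R) := isClosed_closure.completeSpace_coe
  -- The closed graph is complete, so its projections, being isometric, have closed range; density
  -- then makes them onto.
  have s1 : Function.Surjective fun p : _root_.closure R => p.1.1 := by
    rw [← Set.range_eq_univ, ← hc.isometry_fst.isClosedEmbedding.isClosed_range.closure_eq]
    refine (h1.mono ?_).closure_eq
    rintro _ ⟨p, hp, rfl⟩
    exact ⟨⟨p, subset_closure hp⟩, rfl⟩
  have s2 : Function.Surjective fun p : _root_.closure R => p.1.2 := by
    rw [← Set.range_eq_univ, ← hc.isometry_snd.isClosedEmbedding.isClosed_range.closure_eq]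
    refine (h2.mono ?_).closure_eq
    rintro _ ⟨p, hp, rfl⟩
    exact ⟨⟨p, subset_closure hp⟩, rfl⟩
  let e1 : _root_.closure R ≃ᵢ X :=
    ⟨Equiv.ofBijective _ ⟨hc.isometry_fst.injective, s1⟩, hc.isometry_fst⟩
  let e2 : _root_.closure R ≃ᵢ Y :=
    ⟨Equiv.ofBijective _ ⟨hc.isometry_snd.injective, s2⟩, hc.isometry_snd⟩
  refine ⟨e1.symm.trans e2, fun p hp => ?_⟩
  have : e1.symm p.1 = ⟨p, subset_closure hp⟩ := by
    rw [IsometryEquiv.symm_apply_eq]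
    rfl
  rw [IsometryEquiv.trans_apply, this]
  rfl

theorem insert {p : X × Y} (hR : IsPartialIsometry R)
    (hp : ∀ q ∈ R, dist p.1 q.1 = dist p.2 q.2) : IsPartialIsometry (insert p R) := by
  rintro a (rfl | ha) b (rfl | hb)
  · simp
  · exact hp b hb
  · rw [dist_comm, hp a ha, dist_comm]
  · exact hR a ha b hb

end IsPartialIsometry

namespace IsUrysohnOne

variable {U : Type*} [MetricSpace U]

/-- The "forth" step; applied to the swapped graph it gives "back". -/
theorem exists_isPartialIsometry_insert (hU : IsUrysohnOne U) {R : Set (U × U)}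
    (hfin : R.Finite) (hR : IsPartialIsometry R) (u : U) :
    ∃ v : U, IsPartialIsometry (insert (u, v) R) := by
  classical
  have hex : ∀ x ∈ Prod.fst '' R, ∃ y, (x, y) ∈ R := by
    rintro _ ⟨p, hp, rfl⟩
    exact ⟨p.2, hp⟩
  choose! φ hφ using hex
  obtain ⟨v, hv⟩ := hU.exists_dist_eq hU.dist_le_one (hfin.image Prod.fst) φ
    (fun a ha b hb => (hR _ (hφ a ha) _ (hφ b hb)).symm) u
  refine ⟨v, hR.insert fun q hq => ?_⟩
  have h1 := hφ q.1 ⟨q, hq, rfl⟩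
  have h2 : φ q.1 = q.2 := by
    have := hR _ h1 q hq
    simpa [eq_comm] using this
  rw [← h2]
  exact (hv q.1 ⟨q, hq, rfl⟩).symm

/-- The Urysohn space is ultrahomogeneous. -/
theorem exists_isometryEquiv_of_isPartialIsometry (hU : IsUrysohnOne U) {R : Set (U × U)}
    (hfin : R.Finite) (hR : IsPartialIsometry R) :
    ∃ g : U ≃ᵢ U, ∀ p ∈ R, g p.1 = p.2 := by
  have := hU.complete
  have := hU.separable
  have := hU.nonempty
  let P : Type _ := {S : Set (U × U) // S.Finite ∧ IsPartialIsometry S}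
  -- An ideal meeting all these cofinal sets has a union whose domain and range contain a dense
  -- sequence.
  let D : ℕ ⊕ ℕ → Order.Cofinal P := Sum.elim
    (fun n => ⟨{S | TopologicalSpace.denseSeq U n ∈ Prod.fst '' S.1}, fun S => by
      obtain ⟨v, hv⟩ := hU.exists_isPartialIsometry_insert S.2.1 S.2.2
        (TopologicalSpace.denseSeq U n)
      exact ⟨⟨_, S.2.1.insert _, hv⟩, ⟨_, Set.mem_insert _ _, rfl⟩, Set.subset_insert _ _⟩⟩)
    (fun n => ⟨{S | TopologicalSpace.denseSeq U n ∈ Prod.snd '' S.1}, fun S => by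
      obtain ⟨v, hv⟩ := hU.exists_isPartialIsometry_insert
        (S.2.1.preimage Prod.swap_injective.injOn) S.2.2.swap (TopologicalSpace.denseSeq U n)
      refine ⟨⟨insert (v, TopologicalSpace.denseSeq U n) S.1, S.2.1.insert _, ?_⟩,
        ⟨_, Set.mem_insert _ _, rfl⟩, Set.subset_insert _ _⟩
      refine S.2.2.insert fun q hq => ?_
      exact (hv _ (Set.mem_insert _ _) q.swap (Set.mem_insert_of_mem _ hq)).symm⟩)
  let p0 : P := ⟨R, hfin, hR⟩
  let I := Order.idealOfCofinals p0 D
  let T : Set (U × U) := ⋃ S ∈ I, S.1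
  have hT : IsPartialIsometry T := by
    intro p hp q hq
    obtain ⟨S, hS, hpS⟩ := Set.mem_iUnion₂.1 hp
    obtain ⟨S', hS', hqS⟩ := Set.mem_iUnion₂.1 hq
    obtain ⟨W, -, h1, h2⟩ := I.directed S hS S' hS'
    exact W.2.2 p (h1 hpS) q (h2 hqS)
  have key : ∀ i, ∃ S ∈ D i, S.1 ⊆ T := fun i => by
    obtain ⟨S, hS, hSI⟩ := Order.cofinal_meets_idealOfCofinals p0 D i
    exact ⟨S, hS, Set.subset_biUnion_of_mem (u := fun S : P => S.1) hSI⟩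
  obtain ⟨g, hg⟩ := hT.exists_isometryEquiv
    ((TopologicalSpace.denseRange_denseSeq U).mono (by
      rintro _ ⟨n, rfl⟩
      obtain ⟨S, hS, hST⟩ := key (Sum.inl n)
      exact Set.image_mono hST hS))
    ((TopologicalSpace.denseRange_denseSeq U).mono (by
      rintro _ ⟨n, rfl⟩
      obtain ⟨S, hS, hST⟩ := key (Sum.inr n)
      exact Set.image_mono hST hS))
  exact ⟨g, fun p hp => hg p
    (Set.mem_biUnion (Order.mem_idealOfCofinals p0 D : p0 ∈ I) hp)⟩

end IsUrysohnOne

/-! ### Gluing tuples, and compactness of distance matrices -/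

/-- The metric `min 1 d`. -/
abbrev MetricSpace.truncate {X : Type*} (m : MetricSpace X) : MetricSpace X where
  dist x y := min 1 (m.dist x y)
  dist_self x := by
    rw [show m.dist x x = 0 from dist_self x]
    simp
  dist_comm x y := by rw [show m.dist x y = m.dist y x from dist_comm x y]
  dist_triangle x y z := by
    have h : m.dist x z ≤ m.dist x y + m.dist y z := dist_triangle x y z
    have h1 : 0 ≤ m.dist x y := dist_nonneg
    have h2 : 0 ≤ m.dist y z := dist_nonneg
    change min 1 (m.dist x z) ≤ min 1 (m.dist x y) + min 1 (m.dist y z)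
    rcases min_cases 1 (m.dist x z) with ⟨h3, _⟩ | ⟨h3, _⟩ <;>
    rcases min_cases 1 (m.dist x y) with ⟨h4, _⟩ | ⟨h4, _⟩ <;>
    rcases min_cases 1 (m.dist y z) with ⟨h5, _⟩ | ⟨h5, _⟩ <;> linarith
  eq_of_dist_eq_zero {x y} h := by
    have h' : min 1 (m.dist x y) = 0 := h
    refine @eq_of_dist_eq_zero _ m x y ?_
    rcases min_cases 1 (m.dist x y) with ⟨h3, _⟩ | ⟨h3, _⟩ <;> linarith

namespace IsUrysohnOne

variable {U : Type*} [MetricSpace U]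

/-- Two finite families in the Urysohn space whose distances differ by at most `2 ε` can be moved
to within `ε` of each other. -/
theorem exists_isometryEquiv_dist_le (hU : IsUrysohnOne U) {ι : Type*} [Finite ι]
    (x a : ι → U) {ε : ℝ} (hε : 0 < ε)
    (h : ∀ i j, |dist (x i) (x j) - dist (a i) (a j)| ≤ 2 * ε) :
    ∃ g : U ≃ᵢ U, ∀ i, dist (x i) (g (a i)) ≤ ε := by
  cases isEmpty_or_nonempty ι
  · exact ⟨IsometryEquiv.refl U, fun i => isEmptyElim i⟩
  -- Ranges replace `ι` because the families may repeat points. Glued distances may exceed `1`,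
  -- hence the truncation.
  let m : MetricSpace (Set.range x ⊕ Set.range a) :=
    Metric.glueMetricApprox (Set.rangeFactorization x) (Set.rangeFactorization a) ε hε h
  let _ : MetricSpace (Set.range x ⊕ Set.range a) := m.truncate
  have hl : ∀ p q : Set.range x, dist (Sum.inl p : Set.range x ⊕ Set.range a) (Sum.inl q) =
      dist (p : U) q := fun p q => min_eq_right (hU.dist_le_one _ _)
  have hr : ∀ p q : Set.range a, dist (Sum.inr p : Set.range x ⊕ Set.range a) (Sum.inr q) =
      dist (p : U) q := fun p q => min_eq_right (hU.dist_le_one _ _)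
  have hlr : ∀ i, dist (Sum.inl (Set.rangeFactorization x i) : Set.range x ⊕ Set.range a)
      (Sum.inr (Set.rangeFactorization a i)) ≤ ε := fun i =>
    (min_le_right _ _).trans (Metric.glueDist_glued_points _ _ ε i).le
  obtain ⟨ψ, hψ, hext⟩ := hU.exists_isometry_eqOn (fun p q => min_le_left _ _)
    (Set.range Sum.inl) (Sum.elim Subtype.val Subtype.val) (by
      rintro _ ⟨p, rfl⟩ _ ⟨q, rfl⟩
      exact (hl p q).symm)
  obtain ⟨g, hg⟩ := hU.exists_isometryEquiv_of_isPartialIsometry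
    (R := Set.range fun i => (a i, ψ (Sum.inr (Set.rangeFactorization a i))))
    (Set.finite_range _) (by
      rintro _ ⟨i, rfl⟩ _ ⟨j, rfl⟩
      exact ((hψ.dist_eq (Sum.inr (Set.rangeFactorization a i))
        (Sum.inr (Set.rangeFactorization a j))).trans (hr _ _)).symm)
  refine ⟨g, fun i => ?_⟩
  have h1 : x i = ψ (Sum.inl (Set.rangeFactorization x i)) := (hext ⟨Set.rangeFactorization x i, rfl⟩).symm
  rw [hg _ ⟨i, rfl⟩, h1, hψ.dist_eq]
  exact hlr i

/-- In any set of finite families in the Urysohn space there are finitely many whose translates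
by isometries approximate all of them. -/
theorem exists_finite_subset_dist_lt (hU : IsUrysohnOne U) {ι : Type*} [Finite ι]
    (S : Set (ι → U)) {ε : ℝ} (hε : 0 < ε) :
    ∃ A ⊆ S, A.Finite ∧ ∀ x ∈ S, ∃ a ∈ A, ∃ g : U ≃ᵢ U, ∀ i, dist (x i) (g (a i)) < ε := by
  have := Fintype.ofFinite ι
  let D : (ι → U) → ι × ι → ℝ := fun x p => dist (x p.1) (x p.2)
  have hb : TotallyBounded (D '' S) := by
    refine (isCompact_Icc (a := (0 : ι × ι → ℝ)) (b := 1)).totallyBounded.subset ?_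
    rintro _ ⟨x, -, rfl⟩
    exact ⟨fun p => dist_nonneg, fun p => hU.dist_le_one _ _⟩
  -- The net is taken inside `D '' S`, so that its tuples can be chosen in `S`.
  obtain ⟨t, hts, htf, ht⟩ := Metric.finite_approx_of_totallyBounded hb ε hε
  have := hU.nonempty
  have hts' : ∀ y ∈ t, ∃ x ∈ S, D x = y := fun y hy => hts hy
  choose! c hcS hcD using hts'
  refine ⟨c '' t, Set.image_subset_iff.2 hcS, htf.image c, fun x hx => ?_⟩
  obtain ⟨y, hy, hxy⟩ := Set.mem_iUnion₂.1 (ht ⟨x, hx, rfl⟩)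
  rw [Metric.mem_ball, ← hcD y hy] at hxy
  obtain ⟨g, hg⟩ := hU.exists_isometryEquiv_dist_le x (c y) (half_pos hε) fun i j => by
    have := (dist_le_pi_dist (D x) (D (c y)) (i, j)).trans hxy.le
    rw [Real.dist_eq] at this
    linarith
  exact ⟨c y, ⟨y, hy, rfl⟩, g, fun i => (hg i).trans_lt (half_lt_self hε)⟩

end IsUrysohnOne

/-! ### Roelcke precompactness and bounded orbits -/

theorem IsometryEquiv.exists_finite_of_mem_nhds_one {X : Type*} [MetricSpace X]
    {V : Set (X ≃ᵢ X)} (hV : V ∈ 𝓝 (1 : X ≃ᵢ X)) :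
    ∃ I : Set X, I.Finite ∧ ∃ ε > 0, ∀ g : X ≃ᵢ X, (∀ x ∈ I, dist (g x) x < ε) → g ∈ V := by
  rw [nhds_induced, Filter.mem_comap] at hV
  obtain ⟨W, hW, hWV⟩ := hV
  rw [nhds_pi, Filter.mem_pi] at hW
  obtain ⟨I, hI, t, ht, htW⟩ := hW
  have hev : ∀ᶠ ε in 𝓝[>] (0 : ℝ), ∀ x ∈ I, Metric.ball x ε ⊆ t x := by
    rw [Filter.eventually_all_finite hI]
    intro x _
    obtain ⟨r, hr, hrt⟩ := Metric.mem_nhds_iff.1 (ht x)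
    filter_upwards [Ioo_mem_nhdsGT hr] with ε hε
    exact (Metric.ball_subset_ball hε.2.le).trans hrt
  obtain ⟨ε, hε, hpos⟩ := (hev.and self_mem_nhdsWithin).exists
  exact ⟨I, hI, ε, hpos, fun g hg => hWV (htW fun x hx => hε x hx (hg x hx))⟩

/-- The isometry group of the Urysohn space is Roelcke precompact. -/
theorem IsUrysohnOne.exists_finite_mul_mul {U : Type*} [MetricSpace U] (hU : IsUrysohnOne U)
    {V : Set (U ≃ᵢ U)} (hV : V ∈ 𝓝 (1 : U ≃ᵢ U)) :
    ∃ F : Set (U ≃ᵢ U), F.Finite ∧ ∀ g, ∃ v ∈ V, ∃ f ∈ F, ∃ w ∈ V, g = v * f * w := by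
  obtain ⟨I, hI, ε, hε, hIV⟩ := IsometryEquiv.exists_finite_of_mem_nhds_one hV
  have : Finite I := hI
  -- If `k` moves `c f` close to `c g`, the left half puts `k` in `V`, and the right half puts `(k *
  -- f)⁻¹ * g` in `V`.
  let c : (U ≃ᵢ U) → I ⊕ I → U := fun g => Sum.elim (fun x => x) (fun x => g x)
  obtain ⟨A, hA, hAf, happ⟩ := hU.exists_finite_subset_dist_lt (Set.range c) hε
  have hA' : ∀ a ∈ A, ∃ g, c g = a := fun a ha => hA ha
  choose! s hs using hA'
  refine ⟨s '' A, hAf.image s, fun g => ?_⟩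
  obtain ⟨a, ha, k, hk⟩ := happ (c g) ⟨g, rfl⟩
  rw [← hs a ha] at hk
  refine ⟨k, hIV k fun x hx => ?_, s a, ⟨a, ha, rfl⟩, (k * s a)⁻¹ * g, hIV _ fun x hx => ?_,
    by group⟩
  · rw [dist_comm]
    exact hk (Sum.inl ⟨x, hx⟩)
  · rw [← (k * s a).dist_eq, ← IsometryEquiv.mul_apply, mul_inv_cancel_left]
    exact hk (Sum.inr ⟨x, hx⟩)

theorem mainTheorem5 (U : Type u) [MetricSpace U] (hU : IsUrysohnOne U) :
    IsApproxOligomorphic (⊤ : Subgroup (U ≃ᵢ U)) ∧ HasPropertyOB.{u, v} (U ≃ᵢ U) := by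
  constructor
  · intro n _ ε hε
    obtain ⟨A, -, hA, h⟩ := hU.exists_finite_subset_dist_lt (ι := Fin n) Set.univ hε
    refine ⟨A, hA, fun x => ?_⟩
    obtain ⟨a, ha, g, hg⟩ := h x (Set.mem_univ x)
    exact ⟨a, ha, g, Subgroup.mem_top g, (dist_pi_lt_iff hε).2 hg⟩
  · intro X _ _ _ hcont z
    have hV : {g : U ≃ᵢ U | dist (g • z) z < 1} ∈ 𝓝 (1 : U ≃ᵢ U) :=
      (isOpen_lt ((hcont z).dist continuous_const) continuous_const).mem_nhds (by simp)
    obtain ⟨F, hF, h⟩ := hU.exists_finite_mul_mul hV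
    obtain ⟨C, hC⟩ := (hF.image fun f => dist (f • z) z).bddAbove
    refine (Metric.isBounded_iff_subset_closedBall z).2 ⟨1 + C + 1, ?_⟩
    rintro _ ⟨g, rfl⟩
    obtain ⟨v, hv, f, hf, w, hw, rfl⟩ := h g
    have hfC : dist (f • z) z ≤ C := hC ⟨f, hf, rfl⟩
    have h1 : dist ((v * f * w) • z) ((v * f) • z) < 1 := by
      rw [mul_smul (v * f), dist_smul]
      exact hw
    have h2 : dist ((v * f) • z) (v • z) ≤ C := by
      rwa [mul_smul, dist_smul]
    have h3 : dist (v • z) z < 1 := hv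
    rw [Metric.mem_closedBall]
    change dist ((v * f * w) • z) z ≤ _
    linarith [dist_triangle4 ((v * f * w) • z) ((v * f) • z) (v • z) z]
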